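/- Let $(W,S)$ be a Coxeter system with $W$ finite and $S=\{s_1,\dots,s_r\}$, let $\ell$ be its length function, and let $\mathcal G$ be its Coxeter diagram, the graph on $\{1,\dots,r\}$ in which $i\neq j$ are adjacent if and only if $s_is_j$ has order at least $3$. For $C\subseteq\{1,\dots,r\}$ let $W_C$ be the subgroup of $W$ generated by $\{s_i : i\in C\}$, and let $w_0(W_C)$ be its element of maximal length. For $w\in W$ let $J(w)=\{j : \ell(s_jw)<\ell(w)\}$ be its set of left descents. For $I\subseteq J(w)$, let $C^{(1)},\dots,C^{(m)}$ be the vertex sets of the connected components of the subdiagram of $\mathcal G$ induced on $I$. The element $w$ is called $I$-spherical if it has a reduced word $w=s_{i_1}\cdots s_{i_{\ell(w)}}$ such that 1. $\#\{t : i_t=j\}\le 1$ for every $j\in\{1,\dots,r\}\setminus I$, and 2. $\#\{t : i_t\in C^{(z)}\}\le \ell(w_0(W_{C^{(z)}}))+\#C^{(z)}$ for every $1\le z\le m$. **Theorem.** For each of the four families of finite Coxeter groups, $W_n$ of type $A_n$, $W_n$ of type $B_n$, $W_n$ of type $D_n$, and $W_n$ of type $I_2(n)$ (the dihedral group of order $2n$),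 if $w$ is drawn uniformly at random from $W_n$, then $$\Pr[\,w \text{ is } J(w)\text{-spherical}\,]\longrightarrow 0\qquad\text{as } n\to\infty.$$ -/

import Mathlib

open Filter Topology

/-- The Coxeter matrix of type `D_n` (for `n ≥ 4`) on the vertices `0, 1, …, n - 1`: the vertices
`0, …, n - 2` form a path, and the last vertex `n - 1` is joined to `n - 3` only; all edges have
label `3`. (Mathlib's `CoxeterMatrix.D` is not used, because there `n - 1` is also joined to
`n - 2`, which creates a triangle.) For `n = 0, 1, 2, 3` it describes the trivial group, `A_1`,
`A_1 × A_1` and `A_3`. -/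
def CoxeterMatrix.typeD (n : ℕ) : CoxeterMatrix (Fin n) where
  M := Matrix.of fun i j : Fin n ↦
    if i = j then 1
    else if ((i : ℕ) + 1 = j ∧ (j : ℕ) + 1 < n) ∨ ((j : ℕ) + 1 = i ∧ (i : ℕ) + 1 < n) ∨
        ((i : ℕ) + 2 = j ∧ (j : ℕ) + 1 = n) ∨ ((j : ℕ) + 2 = i ∧ (i : ℕ) + 1 = n) then 3
    else 2
  isSymm := by
    ext i j
    simp only [Matrix.transpose_apply, Matrix.of_apply]
    grind
  diagonal := by simp
  off_diagonal := by
    intro i j h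
    simp only [Matrix.of_apply, if_neg h]
    grind

/-- The Coxeter diagram of a Coxeter matrix, as a graph: `i` and `j` are joined when
`3 ≤ M i j ≤ ∞` (Mathlib encodes the entry `∞` as `0`). -/
def CoxeterMatrix.diagram {B : Type*} (M : CoxeterMatrix B) : SimpleGraph B where
  Adj i j := M i j = 0 ∨ 3 ≤ M i j
  symm := ⟨fun i j h ↦ by rwa [M.symmetric j i]⟩
  loopless := ⟨fun i h ↦ by simp at h⟩

namespace CoxeterSystem

variable {B W : Type*} [Group W] {M : CoxeterMatrix B} (cs : CoxeterSystem M W)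

/-- The set `J(w)` of left descents of `w`. -/
def leftDescents (w : W) : Set B := {j | cs.length (cs.simple j * w) < cs.length w}

/-- The parabolic subgroup `W_I`, generated by the simple reflections `s_i` with `i ∈ I`. -/
def parabolic (I : Set B) : Subgroup W := Subgroup.closure (cs.simple '' I)

/-- `ℓ(w₀(W_I))`, the length of the longest element of the parabolic subgroup `W_I`: the maximum
of the lengths of the elements of `W_I` (meaningful when `W_I` is finite). -/
noncomputable def longestLength (I : Set B) : ℕ :=
  sSup (cs.length '' (cs.parabolic I : Set W))

open Classical in
/-- `w` is `I`-spherical, for a set `I` of left descents of `w`: some reduced word of `w` uses each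
letter outside `I` at most once and, for each connected component `C` of the subdiagram induced on
`I`, contains at most `ℓ(w₀(W_C)) + #C` letters from `C`. -/
def IsSpherical (I : Set B) (w : W) : Prop :=
  I ⊆ cs.leftDescents w ∧
  ∃ ω : List B, cs.IsReduced ω ∧ cs.wordProd ω = w ∧
    (∀ j, j ∉ I → ω.count j ≤ 1) ∧
    ∀ c : (M.diagram.induce I).ConnectedComponent,
      ω.countP (fun i ↦ decide (i ∈ Subtype.val '' c.supp)) ≤
        cs.longestLength (Subtype.val '' c.supp) + (Subtype.val '' c.supp).ncard

/-- The probability that a uniformly random element `w` of the (finite) group `W` is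
`J(w)`-spherical. -/
noncomputable def probSpherical : ℝ :=
  (Nat.card {w : W // cs.IsSpherical (cs.leftDescents w) w} : ℝ) / (Nat.card W : ℝ)

end CoxeterSystem

/-! Condition 1 on reduced words already makes sphericity rare.

In types A, B and D, let `W` act on `ℕ` with every generator but the last acting as an adjacent
transposition. Fix `k` and take `k` pairwise commuting generators. Multiplying by one of them flips
its own left descent and preserves those of the others, so all `k` are descents with probability at
most `2⁻ᵏ` (`two_pow_mul_ncard_le`). Otherwise some chosen `s_j` is not a descent, so a spherical
`w` has a word using `j` at most once. Such a `w` maps the initial block ending at `j` into itself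
with at most one exception, so it sends `0` or `1` to one of the first `2k` points. By transitivity
each of these `4k` events has probability at most `1/n`. Thus the probability is at most `2⁻ᵏ +
4k/n`; let `n → ∞`, then `k → ∞`.

In a dihedral group at most one element has both descents. Any other spherical element has an
alternating word using some letter at most once, hence of length at most 3. The count is bounded
while the order is at least `n`.

Independence of commuting descents rests on the reflection cocycle. Finiteness is proved from the
presentations: B by induction on cosets, A as a quotient of B, D inside an image of B. -/

/-! ### The reflection cocycle and left descents -/

lemma sum_range_two_mul_add {A : Type*} [AddCommMonoid A] (h : ℕ → A) (m : ℕ) :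
    ∑ q ∈ Finset.range m, (h (2 * q) + h (2 * q + 1)) = ∑ k ∈ Finset.range (m + m), h k := by
  induction m with
  | zero => simp
  | succ m ih =>
    rw [Finset.sum_range_succ, ih, show m + 1 + (m + 1) = m + m + 1 + 1 by ring,
      Finset.sum_range_succ, Finset.sum_range_succ, add_assoc, two_mul]

lemma mul_mul_pow_eq_inv_mul_of_involutions {G : Type*} [Group G] {a b : G}
    (ha : a * a = 1) (hb : b * b = 1) (k : ℕ) :
    b * (a * b) ^ k = ((a * b) ^ k)⁻¹ * b := by
  have hb' : b⁻¹ = b := inv_eq_of_mul_eq_one_left hb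
  have ha' : a⁻¹ = a := inv_eq_of_mul_eq_one_left ha
  have h : b * (a * b) * b⁻¹ = (a * b)⁻¹ := by simp [mul_assoc, ha', hb', hb]
  have h2 := conj_pow (a := b) (b := a * b) (i := k)
  rw [h, inv_pow] at h2
  rw [h2]; group

namespace CoxeterSystem

variable {B W : Type*} [Group W] {M : CoxeterMatrix B} (cs : CoxeterSystem M W)

open Classical in
/-- The map `(t, ε) ↦ (sᵢ t sᵢ, ε + [t = sᵢ])` on `W × ℤ/2`. -/
noncomputable def signedConjFun (i : B) (p : W × ZMod 2) : W × ZMod 2 :=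
  (cs.simple i * p.1 * cs.simple i, p.2 + if p.1 = cs.simple i then 1 else 0)

open Classical in
lemma signedConjFun_involutive (i : B) : Function.Involutive (cs.signedConjFun i) := by
  rintro ⟨t, e⟩
  have h : cs.simple i * t * cs.simple i = cs.simple i ↔ t = cs.simple i := by
    constructor
    · intro h
      have := congrArg (fun x ↦ cs.simple i * x * cs.simple i) h
      simpa [mul_assoc] using this
    · rintro rfl; simp
  ext1
  · simp [signedConjFun, mul_assoc]
  · change e + ite (t = cs.simple i) 1 0 + ite (cs.simple i * t * cs.simple i = cs.simple i) 1 0 = e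
    by_cases ht : t = cs.simple i
    · rw [if_pos ht, if_pos (h.mpr ht), add_assoc, CharTwo.add_self_eq_zero, add_zero]
    · rw [if_neg ht, if_neg (mt h.mp ht), add_zero, add_zero]

/-- `signedConjFun` as a permutation. -/
noncomputable def signedConj (i : B) : Equiv.Perm (W × ZMod 2) :=
  (cs.signedConjFun_involutive i).toPerm

open Classical in
lemma signedConj_apply (i : B) (t : W) (e : ZMod 2) : cs.signedConj i (t, e) =
    (cs.simple i * t * cs.simple i, e + if t = cs.simple i then 1 else 0) := rfl

open Classical in
-- The `2r` simple steps test `t` against successive reflections of the dihedral group generated by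
-- `s_i` and `s_j`; each factor `s_i s_j` contributes the two with indices `2q` and `2q + 1`.
lemma signedConj_mul_pow_apply (i j : B) (r : ℕ) (t : W) (e : ZMod 2) :
    ((cs.signedConj i * cs.signedConj j) ^ r) (t, e) =
      ((cs.simple i * cs.simple j) ^ r * t * ((cs.simple i * cs.simple j) ^ r)⁻¹,
        e + ∑ k ∈ Finset.range (r + r),
          if t = ((cs.simple i * cs.simple j) ^ k)⁻¹ * cs.simple j then 1 else 0) := by
  rw [← sum_range_two_mul_add]
  induction r with
  | zero => simp
  | succ r ih =>
    rw [pow_succ', Equiv.Perm.mul_apply, ih, Finset.sum_range_succ, Equiv.Perm.mul_apply,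
      signedConj_apply, signedConj_apply]
    have hc := mul_mul_pow_eq_inv_mul_of_involutions (cs.simple_mul_simple_self i)
      (cs.simple_mul_simple_self j) r
    have hij : (cs.simple i * cs.simple j)⁻¹ = cs.simple j * cs.simple i := by simp
    have h1 : (cs.simple i * cs.simple j) ^ r * t * ((cs.simple i * cs.simple j) ^ r)⁻¹ =
        cs.simple j ↔ t = ((cs.simple i * cs.simple j) ^ (2 * r))⁻¹ * cs.simple j := by
      rw [mul_inv_eq_iff_eq_mul, hc, ← eq_inv_mul_iff_mul_eq, two_mul, pow_add, mul_inv_rev,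
        mul_assoc]
    have h2 : cs.simple j * ((cs.simple i * cs.simple j) ^ r * t *
        ((cs.simple i * cs.simple j) ^ r)⁻¹) * cs.simple j = cs.simple i ↔
        t = ((cs.simple i * cs.simple j) ^ (2 * r + 1))⁻¹ * cs.simple j := by
      rw [← eq_mul_inv_iff_mul_eq, ← eq_inv_mul_iff_mul_eq, inv_simple, mul_inv_eq_iff_eq_mul,
        ← mul_assoc (cs.simple j), ← hij, mul_assoc, hc, ← eq_inv_mul_iff_mul_eq,
        show 2 * r + 1 = r + (1 + r) by ring, pow_add, pow_add, pow_one]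
      simp only [mul_inv_rev, mul_assoc]
    rw [if_congr h1 rfl rfl, if_congr h2 rfl rfl]
    ext1
    · simp only [mul_inv_rev, inv_simple, pow_succ', mul_assoc]
    · simp only [add_assoc]

lemma signedConj_isLiftable : M.IsLiftable cs.signedConj := by
  classical
  intro i j
  ext1 ⟨t, e⟩
  -- The list of `2 * M i j` reflections has period `M i j`, so its two halves cancel modulo 2.
  rw [signedConj_mul_pow_apply, Finset.sum_range_add]
  have h : ∀ k, (cs.simple i * cs.simple j) ^ (M i j + k) = (cs.simple i * cs.simple j) ^ k := by
    intro k
    rw [pow_add, simple_mul_simple_pow, one_mul]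
  simp only [h, simple_mul_simple_pow, CharTwo.add_self_eq_zero]
  simp

/-- The action of `W` on `W × ℤ/2` lifting conjugation and recording inversions. -/
noncomputable def signedAction : W →* Equiv.Perm (W × ZMod 2) :=
  cs.lift ⟨cs.signedConj, cs.signedConj_isLiftable⟩

lemma signedAction_simple (i : B) : cs.signedAction (cs.simple i) = cs.signedConj i :=
  cs.lift_apply_simple _ _

open Classical in
lemma signedAction_wordProd (ω : List B) (t : W) (e : ZMod 2) :
    cs.signedAction (cs.wordProd ω) (t, e) =
      (cs.wordProd ω * t * (cs.wordProd ω)⁻¹, e + ((cs.rightInvSeq ω).count t : ZMod 2)) := by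
  induction ω with
  | nil => simp
  | cons i ω ih =>
    rw [wordProd_cons, map_mul, Equiv.Perm.mul_apply, ih, signedAction_simple, signedConj_apply,
      rightInvSeq, List.count_cons]
    have h : cs.wordProd ω * t * (cs.wordProd ω)⁻¹ = cs.simple i ↔
        (cs.wordProd ω)⁻¹ * cs.simple i * cs.wordProd ω = t := by
      rw [mul_inv_eq_iff_eq_mul, ← eq_inv_mul_iff_mul_eq, eq_comm, mul_assoc]
    rw [if_congr h rfl rfl]
    ext1
    · simp [mul_assoc]
    · simp only [beq_iff_eq, Nat.cast_add, Nat.cast_ite, Nat.cast_one, Nat.cast_zero]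
      ring

/-- The parity with which `t` occurs among the right inversions of `w`. -/
noncomputable def inversionParity (w t : W) : ZMod 2 := (cs.signedAction w (t, 0)).2

lemma signedAction_apply (w t : W) (e : ZMod 2) :
    cs.signedAction w (t, e) = (w * t * w⁻¹, e + cs.inversionParity w t) := by
  classical
  obtain ⟨ω, rfl⟩ := cs.wordProd_surjective w
  rw [inversionParity, signedAction_wordProd, signedAction_wordProd]
  simp

/-- The cocycle identity: it turns questions about descents of products into addition in `ℤ/2`. -/
lemma inversionParity_mul (u v t : W) :
    cs.inversionParity (u * v) t = cs.inversionParity v t + cs.inversionParity u (v * t * v⁻¹) := by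
  conv_lhs => rw [inversionParity, map_mul, Equiv.Perm.mul_apply, signedAction_apply,
    signedAction_apply]
  simp

open Classical in
lemma inversionParity_simple (i : B) (t : W) :
    cs.inversionParity (cs.simple i) t = if t = cs.simple i then 1 else 0 := by
  rw [inversionParity, signedAction_simple, signedConj_apply, zero_add]

lemma isRightInversion_of_inversionParity_ne_zero {w t : W} (h : cs.inversionParity w t ≠ 0) :
    cs.IsRightInversion w t := by
  classical
  obtain ⟨ω, hω, rfl⟩ := cs.exists_isReduced w
  refine cs.isRightInversion_of_mem_rightInvSeq hω ?_
  by_contra hc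
  rw [inversionParity, signedAction_wordProd, List.count_eq_zero.mpr hc] at h
  simp at h

lemma isRightDescent_iff_inversionParity {w : W} {i : B} :
    cs.IsRightDescent w i ↔ cs.inversionParity w (cs.simple i) ≠ 0 := by
  rw [← isRightInversion_simple_iff_isRightDescent]
  refine ⟨fun h h0 ↦ ?_, cs.isRightInversion_of_inversionParity_ne_zero⟩
  -- If the parity for `w` were 0, the cocycle identity would give parity 1 for `w * s_i`, making
  -- `s_i` an inversion of `w * s_i` and hence not of `w`.
  rw [← (cs.isReflection_simple i).not_isRightInversion_mul_left_iff] at h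
  refine h (cs.isRightInversion_of_inversionParity_ne_zero ?_)
  rw [inversionParity_mul, inversionParity_simple]
  simp [h0]

lemma isRightDescent_mul_simple_iff {w : W} {i j : B} (hne : cs.simple i ≠ cs.simple j)
    (hM : M i j = 2) : cs.IsRightDescent (w * cs.simple j) i ↔ cs.IsRightDescent w i := by
  have hc : cs.simple j * cs.simple i * (cs.simple j)⁻¹ = cs.simple i := by
    have h := cs.simple_mul_simple_pow i j
    rw [hM, pow_two, ← eq_inv_iff_mul_eq_one] at h
    simp only [mul_inv_rev, inv_simple] at h
    rw [← h, inv_simple, mul_assoc, simple_mul_simple_self, mul_one]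
  rw [isRightDescent_iff_inversionParity, isRightDescent_iff_inversionParity,
    inversionParity_mul, inversionParity_simple, if_neg hne, hc, zero_add]

/-- Left multiplication by a commuting simple reflection does not affect a left descent. -/
lemma isLeftDescent_simple_mul_iff {w : W} {i j : B} (hne : cs.simple i ≠ cs.simple j)
    (hM : M i j = 2) : cs.IsLeftDescent (cs.simple j * w) i ↔ cs.IsLeftDescent w i := by
  rw [← isRightDescent_inv_iff, ← isRightDescent_inv_iff, mul_inv_rev, inv_simple,
    isRightDescent_mul_simple_iff cs hne hM]

end CoxeterSystem

/-! ### Counting elements with many commuting descents -/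

namespace CoxeterSystem

variable {B W : Type*} [Group W] {M : CoxeterMatrix B} (cs : CoxeterSystem M W)

/-- The elements of a finite Coxeter group having all of a set of `k` commuting simple reflections
as left descents form at most a `2⁻ᵏ` fraction of the group. -/
lemma two_pow_mul_ncard_le [Finite W] (K : Finset B)
    (hinj : ∀ i ∈ K, ∀ j ∈ K, i ≠ j → cs.simple i ≠ cs.simple j)
    (hM : ∀ i ∈ K, ∀ j ∈ K, i ≠ j → M i j = 2) :
    2 ^ K.card * {w : W | ∀ i ∈ K, cs.IsLeftDescent w i}.ncard ≤ Nat.card W := by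
  classical
  induction K using Finset.induction_on with
  | empty => simp [Set.ncard_univ]
  | insert j K hj ih =>
    refine le_trans ?_ (ih
      (fun i hi l hl ↦ hinj i (Finset.mem_insert_of_mem hi) l (Finset.mem_insert_of_mem hl))
      (fun i hi l hl ↦ hM i (Finset.mem_insert_of_mem hi) l (Finset.mem_insert_of_mem hl)))
    set F : Set W := {w : W | ∀ i ∈ insert j K, cs.IsLeftDescent w i}
    set G : Set W := {w : W | ∀ i ∈ K, cs.IsLeftDescent w i}
    rw [Finset.card_insert_of_notMem hj, pow_succ, mul_assoc]
    refine Nat.mul_le_mul_left _ ?_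
    -- Left multiplication by `s_j` toggles the descent at `j` and keeps those in `K`, so `F` and
    -- its translate are disjoint subsets of `G` of equal size.
    have hdisj : Disjoint F ((cs.simple j * ·) '' F) := by
      rw [Set.disjoint_left]
      rintro w hw ⟨v, hv, rfl⟩
      exact (cs.isLeftDescent_iff_not_isLeftDescent_mul.mp (hv j (Finset.mem_insert_self j K)))
        (hw j (Finset.mem_insert_self j K))
    have hsub : F ∪ (cs.simple j * ·) '' F ⊆ G := by
      rintro w (hw | ⟨v, hv, rfl⟩) i hi
      · exact hw i (Finset.mem_insert_of_mem hi)
      · have hij : i ≠ j := by rintro rfl; exact hj hi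
        have hi' := Finset.mem_insert_of_mem (a := i) (b := j) hi
        have hj' := Finset.mem_insert_self j K
        exact (cs.isLeftDescent_simple_mul_iff (hinj i hi' j hj' hij) (hM i hi' j hj' hij)).mpr
          (hv i hi')
    have h1 := Set.ncard_le_ncard hsub (Set.toFinite _)
    rw [Set.ncard_union_eq hdisj (Set.toFinite _) (Set.toFinite _),
      Set.ncard_image_of_injective _ (mul_right_injective (cs.simple j))] at h1
    linarith

/-! ### Words using a letter at most once, and the bound for permutation actions -/

section Words

variable {X : Type*} (φ : W →* Equiv.Perm X) (A : Set X) (j : B)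

lemma wordProd_mapsTo_of_count_eq_zero
    (hφ : ∀ i, i ≠ j → ∀ x ∈ A, φ (cs.simple i) x ∈ A) [DecidableEq B]
    (ω : List B) (hω : ω.count j = 0) : ∀ x ∈ A, φ (cs.wordProd ω) x ∈ A := by
  induction ω with
  | nil => simp
  | cons i ω ih =>
    intro x hx
    rw [List.count_eq_zero, List.mem_cons, not_or, ← List.count_eq_zero] at hω
    rw [wordProd_cons, map_mul, Equiv.Perm.mul_apply]
    exact hφ i (Ne.symm hω.1) _ (ih hω.2 x hx)

/-- Only the single occurrence of `j` can push a point out of `A`, and only when that point has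
reached `y`; the exceptional `z` is the preimage of `y` under the letters that act before `j`. -/
lemma wordProd_mapsTo_of_count_le_one
    (hφ : ∀ i, i ≠ j → ∀ x ∈ A, φ (cs.simple i) x ∈ A)
    {y : X} (hy : ∀ x ∈ A, x ≠ y → φ (cs.simple j) x ∈ A) [DecidableEq B]
    (ω : List B) (hω : ω.count j ≤ 1) :
    ∃ z, ∀ x ∈ A, x ≠ z → φ (cs.wordProd ω) x ∈ A := by
  induction ω with
  | nil => exact ⟨y, fun x hx _ ↦ by simpa using hx⟩
  | cons i ω ih =>
    rw [wordProd_cons, map_mul]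
    by_cases hij : i = j
    · subst hij
      have h0 : ω.count i = 0 := by
        rw [List.count_cons_self] at hω; omega
      refine ⟨(φ (cs.wordProd ω)).symm y, fun x hx hxz ↦ ?_⟩
      rw [Equiv.Perm.mul_apply]
      refine hy _ (cs.wordProd_mapsTo_of_count_eq_zero φ A i hφ ω h0 x hx) ?_
      rwa [Ne, ← Equiv.eq_symm_apply]
    · rw [List.count_cons_of_ne hij] at hω
      obtain ⟨z, hz⟩ := ih hω
      exact ⟨z, fun x hx hxz ↦ hφ i hij _ (hz x hx hxz)⟩

end Words

end CoxeterSystem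

/-- In a finite group acting on a set, few elements send one given point to another if the orbit
of the latter is large. -/
lemma card_mul_ncard_map_eq_le {W X : Type*} [Group W] [Finite W] (φ : W →* Equiv.Perm X)
    (Y : Finset X) (a b : X) (hY : ∀ c ∈ Y, ∃ g, φ g b = c) :
    Y.card * {w : W | φ w a = b}.ncard ≤ Nat.card W := by
  choose! g hg using hY
  rw [← Nat.card_coe_set_eq, ← Nat.card_eq_finsetCard Y, ← Nat.card_prod]
  -- The left translates by `g c` lie in the sets of elements sending `a` to `c`, which are disjoint
  -- for distinct `c`.
  refine Nat.card_le_card_of_injective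
    (fun p : Y × {w : W | φ w a = b} ↦ g p.1 * p.2.1) ?_
  rintro ⟨⟨c, hc⟩, ⟨w, hw⟩⟩ ⟨⟨c', hc'⟩, ⟨w', hw'⟩⟩ h
  simp only [Set.mem_ofPred_eq] at hw hw' h
  have h1 : c = c' := by
    have := congrArg (fun x ↦ φ x a) h
    simpa [hw, hw', hg c hc, hg c' hc'] using this
  subst h1
  simpa using h

lemma exists_map_eq_of_swap {W : Type*} [Group W] {n : ℕ} (φ : W →* Equiv.Perm ℕ) (s : Fin n → W)
    (hs : ∀ i : Fin n, (i : ℕ) + 1 < n → φ (s i) = Equiv.swap (i : ℕ) (i + 1))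
    {b c : ℕ} (hb : b < n) (hc : c < n) : ∃ g, φ g b = c := by
  have key : ∀ c < n, ∃ g, φ g 0 = c := by
    intro c
    induction c with
    | zero => exact fun _ ↦ ⟨1, by simp⟩
    | succ c ih =>
      intro hc
      obtain ⟨g, hg⟩ := ih (by omega)
      refine ⟨s ⟨c, by omega⟩ * g, ?_⟩
      rw [map_mul, Equiv.Perm.mul_apply, hg, hs ⟨c, by omega⟩ hc, Equiv.swap_apply_left]
  obtain ⟨g, hg⟩ := key b hb
  obtain ⟨h, hh⟩ := key c hc
  refine ⟨h * g⁻¹, ?_⟩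
  rw [map_mul, Equiv.Perm.mul_apply, map_inv, ← hg, ← Equiv.Perm.mul_apply (φ g)⁻¹,
    inv_mul_cancel, Equiv.Perm.one_apply, hh]

/-- If `W` acts on `ℕ` so that all generators but the last one act by adjacent transpositions, then
only few of its elements are spherical. -/
lemma CoxeterSystem.probSpherical_le {n : ℕ} {W : Type*} [Group W] [Finite W]
    {M : CoxeterMatrix (Fin n)} (cs : CoxeterSystem M W) (φ : W →* Equiv.Perm ℕ)
    (hs : ∀ i : Fin n, (i : ℕ) + 1 < n → φ (cs.simple i) = Equiv.swap (i : ℕ) (i + 1))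
    (hlast : ∀ i : Fin n, (i : ℕ) + 1 = n → ∀ x, x + 2 < n → φ (cs.simple i) x = x)
    (hM : ∀ i j : Fin n, (i : ℕ) + 2 ≤ j → (j : ℕ) + 1 < n → M i j = 2)
    (k : ℕ) (hk : 2 * k + 1 < n) :
    cs.probSpherical ≤ (1 / 2) ^ k + 4 * k / n := by
  classical
  -- Odd indices commute pairwise, and each block `{0, …, 2i + 1}` then contains both `0` and `1`.
  -- The bound on `k` keeps the blocks away from points moved by the last generator.
  let e : Fin k ↪ Fin n := ⟨fun i ↦ ⟨2 * i + 1, by omega⟩, fun i j h ↦ by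
    simp only [Fin.mk.injEq] at h; omega⟩
  have he : ∀ i, (e i : ℕ) = 2 * i + 1 := fun i ↦ rfl
  set K : Finset (Fin n) := Finset.univ.map e
  have hKcard : K.card = k := by simp [K]
  have hM' : ∀ i ∈ K, ∀ j ∈ K, i ≠ j → M i j = 2 := by
    simp only [K, Finset.mem_map, Finset.mem_univ, true_and]
    rintro _ ⟨i, rfl⟩ _ ⟨j, rfl⟩ hij
    have hij' : (i : ℕ) ≠ j := fun h ↦ hij (by rw [Fin.ext h])
    rcases lt_or_gt_of_ne hij' with h | h
    · exact hM _ _ (by rw [he, he]; omega) (by rw [he]; omega)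
    · rw [M.symmetric]
      exact hM _ _ (by rw [he, he]; omega) (by rw [he]; omega)
  have hinj : ∀ i ∈ K, ∀ j ∈ K, i ≠ j → cs.simple i ≠ cs.simple j := by
    simp only [K, Finset.mem_map, Finset.mem_univ, true_and]
    rintro _ ⟨i, rfl⟩ _ ⟨j, rfl⟩ hij h
    have hij' : (i : ℕ) ≠ j := fun h ↦ hij (by rw [Fin.ext h])
    have h1 := congrArg (fun w ↦ φ w (2 * i + 1)) h
    rw [hs _ (by rw [he]; omega), hs _ (by rw [he]; omega), he, he, Equiv.swap_apply_left,
      Equiv.swap_apply_of_ne_of_ne (by omega) (by omega)] at h1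
    omega
  have hF := cs.two_pow_mul_ncard_le K hinj hM'
  rw [hKcard] at hF
  set F : Set W := {w : W | ∀ i ∈ K, cs.IsLeftDescent w i}
  -- The `4k` events that `0` or `1` lands among the first `2k` points.
  let S : Fin 2 × Fin (2 * k) → Set W := fun p ↦ {w : W | φ w p.1 = p.2}
  have hS : ∀ p, n * (S p).ncard ≤ Nat.card W := by
    intro p
    have := card_mul_ncard_map_eq_le φ (Finset.range n) (p.1 : ℕ) (p.2 : ℕ)
      (fun c hc ↦ exists_map_eq_of_swap φ cs.simple hs (by omega) (Finset.mem_range.mp hc))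
    rwa [Finset.card_range] at this
  have hsub : {w : W | cs.IsSpherical (cs.leftDescents w) w} ⊆ F ∪ ⋃ p, S p := by
    rintro w ⟨-, ω, -, rfl, hω, -⟩
    by_cases hF : cs.wordProd ω ∈ F
    · exact Or.inl hF
    right
    simp only [F, K, Set.mem_ofPred_eq, Finset.mem_map, Finset.mem_univ, true_and,
      forall_exists_index, forall_apply_eq_imp_iff, not_forall] at hF
    obtain ⟨i, hi⟩ := hF
    have hcount := hω (e i) hi
    obtain ⟨z, hz⟩ := cs.wordProd_mapsTo_of_count_le_one φ {x | x ≤ 2 * i + 1} (e i)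
      (by
        intro j hj x hx
        have hj' : (j : ℕ) ≠ 2 * i + 1 := fun h ↦ hj (Fin.ext h)
        simp only [Set.mem_ofPred_eq] at hx ⊢
        rcases eq_or_ne ((j : ℕ) + 1) n with h | h
        · rw [hlast j h x (by omega)]
          exact hx
        · rw [hs j (by omega), Equiv.swap_apply_def]
          split_ifs <;> omega)
      (y := 2 * i + 1)
      (by
        intro x hx hne
        simp only [Set.mem_ofPred_eq] at hx ⊢
        rw [hs _ (by rw [he]; omega), he, Equiv.swap_apply_of_ne_of_ne hne (by omega)]
        exact hx)
      ω (by convert hcount)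
    -- The block has at most one exceptional point, so `0` or `1` is not exceptional.
    obtain ⟨a, ha⟩ : ∃ a : Fin 2, (a : ℕ) ≠ z := by
      by_cases h : z = 0
      · exact ⟨1, by subst h; simp⟩
      · exact ⟨0, fun h' ↦ h (by simpa using h'.symm)⟩
    have := hz a (by simp only [Set.mem_ofPred_eq]; omega) ha
    simp only [Set.mem_ofPred_eq] at this
    exact Set.mem_iUnion.mpr ⟨(a, ⟨φ (cs.wordProd ω) a, by omega⟩), rfl⟩
  have hcard : (Nat.card {w : W // cs.IsSpherical (cs.leftDescents w) w}) ≤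
      F.ncard + ∑ p, (S p).ncard := by
    refine le_trans (Set.ncard_le_ncard hsub (Set.toFinite _)) ?_
    refine le_trans (Set.ncard_union_le _ _) (Nat.add_le_add_left ?_ _)
    exact Set.ncard_iUnion_le_of_fintype S
  have hW : (0 : ℝ) < Nat.card W := by exact_mod_cast Nat.card_pos
  have hn : (0 : ℝ) < n := by exact_mod_cast (by omega : 0 < n)
  rw [probSpherical, div_le_iff₀ hW]
  have h1 : (F.ncard : ℝ) ≤ (1 / 2) ^ k * Nat.card W := by
    rw [one_div, inv_pow, ← div_eq_inv_mul, le_div_iff₀' (by positivity)]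
    exact_mod_cast hF
  have h2 : ∑ p, ((S p).ncard : ℝ) ≤ 4 * k / n * Nat.card W := by
    have : ∀ p ∈ Finset.univ, ((S p).ncard : ℝ) ≤ Nat.card W / n := by
      intro p _
      rw [le_div_iff₀' hn]
      exact_mod_cast hS p
    refine (Finset.sum_le_card_nsmul _ _ _ this).trans (le_of_eq ?_)
    simp only [Finset.card_univ, Fintype.card_prod, Fintype.card_fin, nsmul_eq_mul]
    push_cast
    ring
  calc _ ≤ ((F.ncard + ∑ p, (S p).ncard : ℕ) : ℝ) := by exact_mod_cast hcard
    _ ≤ _ := by push_cast; linarith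

lemma tendsto_probSpherical_zero {M : ∀ n : ℕ, CoxeterMatrix (Fin n)} [∀ n, Finite (M n).Group]
    (φ : ∀ n, (M n).Group →* Equiv.Perm ℕ)
    (hs : ∀ n, ∀ i : Fin n, (i : ℕ) + 1 < n →
      φ n ((M n).toCoxeterSystem.simple i) = Equiv.swap (i : ℕ) (i + 1))
    (hlast : ∀ n, ∀ i : Fin n, (i : ℕ) + 1 = n → ∀ x, x + 2 < n →
      φ n ((M n).toCoxeterSystem.simple i) x = x)
    (hM : ∀ n, ∀ i j : Fin n, (i : ℕ) + 2 ≤ j → (j : ℕ) + 1 < n → M n i j = 2) :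
    Tendsto (fun n ↦ (M n).toCoxeterSystem.probSpherical) atTop (𝓝 0) := by
  rw [tendsto_order]
  refine ⟨fun a ha ↦ Eventually.of_forall fun n ↦ ha.trans_le ?_, fun a ha ↦ ?_⟩
  · exact div_nonneg (Nat.cast_nonneg _) (Nat.cast_nonneg _)
  -- `k` is fixed before `n` grows, so that `4k/n` vanishes in the limit.
  obtain ⟨k, hk⟩ := exists_pow_lt_of_lt_one ha (by norm_num : (1 / 2 : ℝ) < 1)
  have hlim : Tendsto (fun n : ℕ ↦ (1 / 2 : ℝ) ^ k + 4 * k / n) atTop (𝓝 ((1 / 2) ^ k + 0)) :=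
    tendsto_const_nhds.add (tendsto_const_nhds.div_atTop tendsto_natCast_atTop_atTop)
  rw [add_zero] at hlim
  filter_upwards [hlim.eventually_lt_const hk, eventually_gt_atTop (2 * k + 1)] with n hn hn'
  exact lt_of_le_of_lt
    ((M n).toCoxeterSystem.probSpherical_le (φ n) (hs n) (hlast n) (hM n) k hn') hn

/-! ### Finiteness of the groups of types B, A and D -/

/-- The orbit of a point under a group with generators `s 0, …, s L` satisfying the braid relations
of type `B` is finite if the point is fixed by all generators but `s 0`. -/
lemma exists_finite_invariant_of_typeB_relations {G Y : Type*} [Group G] [MulAction G Y]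
    (s : ℕ → G) (L : ℕ) (y : Y)
    (hsq : ∀ i, s i * s i = 1)
    (hcomm : ∀ i j, i + 2 ≤ j → j ≤ L → s i * s j = s j * s i)
    (hbraid : ∀ i, i + 1 < L → s i * s (i + 1) * s i = s (i + 1) * s i * s (i + 1))
    (hlast : ∀ i, i + 1 = L → s i * s L * s i * s L = s L * s i * s L * s i)
    (hy : ∀ i, 1 ≤ i → i ≤ L → s i • y = y) :
    ∃ F : Set Y, F.Finite ∧ y ∈ F ∧ ∀ i ≤ L, ∀ z ∈ F, s i • z ∈ F := by
  -- The model is the `2(L + 1)` vertices of a cross-polytope: `c 0, …, c L` are the vectors `e_k`,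
  -- and `d L, …, d 0` below are their negatives. `s k` exchanges neighbours in each chain, and `s
  -- L` exchanges `c L` with `d L`.
  let c : ℕ → Y := fun k ↦ Nat.rec y (fun k z ↦ s k • z) k
  have c0 : c 0 = y := rfl
  have cs : ∀ k, c (k + 1) = s k • c k := fun k ↦ rfl
  have hss : ∀ i (z : Y), s i • s i • z = z := fun i z ↦ by rw [smul_smul, hsq, one_smul]
  have hcomm' : ∀ i j (z : Y), i + 2 ≤ j → j ≤ L → s i • s j • z = s j • s i • z := by
    intro i j z h h'
    rw [smul_smul, smul_smul, hcomm i j h h']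
  have hbraid' : ∀ i (z : Y), i + 1 < L →
      s i • s (i + 1) • s i • z = s (i + 1) • s i • s (i + 1) • z := by
    intro i z h
    simp only [smul_smul, ← mul_assoc]
    rw [hbraid i h]
  have hc : ∀ k ≤ L, ∀ i ≤ L, i ≠ k → i + 1 ≠ k → s i • c k = c k := by
    intro k
    induction k using Nat.strong_induction_on with
    | _ k ih =>
      intro hk i hi h1 h2
      rcases k with _ | k
      · rw [c0, hy i (by omega) hi]
      rw [cs]
      rcases Nat.lt_or_ge (k + 1) i with h | h
      · rw [← hcomm' k i _ (by omega) hi, ih k (by omega) (by omega) i hi (by omega) (by omega)]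
      rcases Nat.lt_or_ge (i + 1) k with h' | h'
      · rw [hcomm' i k _ (by omega) (by omega), ih k (by omega) (by omega) i hi (by omega)
          (by omega)]
      obtain rfl : k = i + 1 := by omega
      rw [cs, hbraid' i _ (by omega),
        ih i (by omega) (by omega) (i + 1) (by omega) (by omega) (by omega)]
  let d : ℕ → Y := fun k ↦ Nat.rec (s L • c L) (fun k z ↦ s (L - 1 - k) • z) (L - k)
  have dL : d L = s L • c L := by simp [d]
  have ds : ∀ k < L, d k = s k • d (k + 1) := by
    intro k hk
    have h1 : L - k = (L - (k + 1)) + 1 := by omega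
    have h2 : L - 1 - (L - (k + 1)) = k := by omega
    simp only [d, h1, h2]
  have hd : ∀ m k, k + m = L → ∀ i ≤ L, i ≠ k → i + 1 ≠ k → s i • d k = d k := by
    intro m
    induction m using Nat.strong_induction_on with
    | _ m ih =>
      intro k hk i hi h1 h2
      rcases m with _ | m
      · obtain rfl : k = L := by omega
        rw [dL, hcomm' i k _ (by omega) le_rfl, hc k le_rfl i hi h1 h2]
      rw [ds k (by omega)]
      rcases Nat.lt_or_ge i k with h | h
      · rw [hcomm' i k _ (by omega) (by omega),
          ih m (by omega) (k + 1) (by omega) i hi (by omega) (by omega)]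
      rcases Nat.lt_or_ge (k + 1) i with h' | h'
      · rw [← hcomm' k i _ (by omega) hi,
          ih m (by omega) (k + 1) (by omega) i hi (by omega) (by omega)]
      obtain rfl : i = k + 1 := by omega
      rcases m with _ | m
      -- The turning point between the two chains, the only place where the relation with label 4
      -- enters.
      · obtain rfl : L = k + 1 := by omega
        have h4 := hlast k rfl
        have h5 := hc k (by omega) (k + 1) le_rfl (by omega) (by omega)
        rw [dL, cs]
        have h6 : s (k + 1) • s k • s (k + 1) • s k • c k =
            s k • s (k + 1) • s k • s (k + 1) • c k := by
          simp only [smul_smul, ← mul_assoc]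
          rw [h4]
        rw [h6, h5]
      · rw [ds (k + 1) (by omega), ← hbraid' k _ (by omega),
          ih m (by omega) (k + 1 + 1) (by omega) k (by omega) (by omega) (by omega)]
  refine ⟨c '' Set.Iic L ∪ d '' Set.Iic L,
    ((Set.finite_Iic L).image c).union ((Set.finite_Iic L).image d),
    Or.inl ⟨0, by simp, rfl⟩, ?_⟩
  have mc : ∀ k ≤ L, c k ∈ c '' Set.Iic L ∪ d '' Set.Iic L := fun k hk ↦ Or.inl ⟨k, hk, rfl⟩
  have md : ∀ k ≤ L, d k ∈ c '' Set.Iic L ∪ d '' Set.Iic L := fun k hk ↦ Or.inr ⟨k, hk, rfl⟩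
  rintro i hi _ (⟨k, hk, rfl⟩ | ⟨k, hk, rfl⟩)
  · have hk : k ≤ L := hk
    by_cases h1 : i = k
    · subst h1
      rcases Nat.lt_or_ge i L with h | h
      · rw [← cs]; exact mc _ h
      · obtain rfl : i = L := by omega
        rw [← dL]; exact md _ le_rfl
    · by_cases h2 : i + 1 = k
      · subst h2
        rw [cs, hss]; exact mc _ hi
      · rw [hc k hk i hi h1 h2]; exact mc _ hk
  · have hk : k ≤ L := hk
    by_cases h1 : i = k
    · subst h1
      rcases Nat.lt_or_ge i L with h | h
      · rw [ds i h, hss]; exact md _ h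
      · obtain rfl : i = L := by omega
        rw [dL, hss]; exact mc _ le_rfl
    · by_cases h2 : i + 1 = k
      · subst h2
        rw [← ds i (by omega)]; exact md _ hi
      · rw [hd (L - k) k (by omega) i hi h1 h2]; exact md _ hk

/-- A group is finite if it has a finite subgroup whose coset lies in a finite set of cosets
invariant under left multiplication by a generating set. -/
lemma finite_of_finite_invariant_cosets {G : Type*} [Group G] (H : Subgroup G) [Finite H]
    (T : Set G) (hT : Submonoid.closure T = ⊤) (F : Set (G ⧸ H)) (hF : F.Finite)
    (h1 : ((1 : G) : G ⧸ H) ∈ F) (hinv : ∀ g ∈ T, ∀ z ∈ F, g • z ∈ F) : Finite G := by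
  have hall : ∀ g : G, ∀ z ∈ F, g • z ∈ F := by
    intro g
    have hg : g ∈ Submonoid.closure T := hT ▸ Submonoid.mem_top g
    induction hg using Submonoid.closure_induction with
    | mem g hg => exact hinv g hg
    | one => simp
    | mul a b _ _ ha hb =>
      intro z hz
      rw [mul_smul]
      exact ha _ (hb z hz)
  have : Finite (G ⧸ H) := by
    refine Set.finite_univ_iff.mp (hF.subset fun z _ ↦ ?_)
    induction z using QuotientGroup.induction_on with
    | H g => simpa using hall g _ h1
  exact Finite.of_equiv _ (Subgroup.groupEquivQuotientProdSubgroup (s := H)).symm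

lemma CoxeterSystem.exists_hom {B W G : Type*} [Group W] [Group G] {M : CoxeterMatrix B}
    (cs : CoxeterSystem M W) (f : B → G) (hf : ∀ i j, (f i * f j) ^ M i j = 1) :
    ∃ φ : W →* G, ∀ i, φ (cs.simple i) = f i :=
  ⟨cs.lift ⟨f, hf⟩, fun i ↦ cs.lift_apply_simple hf i⟩

lemma CoxeterMatrix.B_succ_succ (n : ℕ) (i j : Fin n) :
    CoxeterMatrix.B (n + 1) i.succ j.succ = CoxeterMatrix.B n i j := by
  simp only [CoxeterMatrix.B, Matrix.of_apply, Fin.ext_iff, Fin.val_succ]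
  grind

lemma CoxeterSystem.mul_comm_of_eq_two {B W : Type*} [Group W] {M : CoxeterMatrix B}
    (cs : CoxeterSystem M W) {i j : B} (h : M i j = 2) :
    cs.simple i * cs.simple j = cs.simple j * cs.simple i := by
  have := cs.simple_mul_simple_pow i j
  rw [h, pow_two, mul_eq_one_iff_eq_inv] at this
  simpa using this

lemma CoxeterSystem.braid_of_eq_three {B W : Type*} [Group W] {M : CoxeterMatrix B}
    (cs : CoxeterSystem M W) {i j : B} (h : M i j = 3) :
    cs.simple i * cs.simple j * cs.simple i = cs.simple j * cs.simple i * cs.simple j := by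
  have := cs.simple_mul_simple_pow i j
  rw [h, show (cs.simple i * cs.simple j) ^ 3 = (cs.simple i * cs.simple j * cs.simple i) *
    (cs.simple j * cs.simple i * cs.simple j) by simp only [pow_succ, pow_zero, one_mul, mul_assoc],
    mul_eq_one_iff_eq_inv] at this
  simpa [mul_assoc] using this

lemma CoxeterSystem.braid_of_eq_four {B W : Type*} [Group W] {M : CoxeterMatrix B}
    (cs : CoxeterSystem M W) {i j : B} (h : M i j = 4) :
    cs.simple i * cs.simple j * cs.simple i * cs.simple j =
      cs.simple j * cs.simple i * cs.simple j * cs.simple i := by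
  have := cs.simple_mul_simple_pow i j
  rw [h, show (cs.simple i * cs.simple j) ^ 4 =
    (cs.simple i * cs.simple j * cs.simple i * cs.simple j) *
    (cs.simple i * cs.simple j * cs.simple i * cs.simple j) by
      simp only [pow_succ, pow_zero, one_mul, mul_assoc],
    mul_eq_one_iff_eq_inv] at this
  simpa [mul_assoc] using this

instance CoxeterMatrix.finite_group_B (n : ℕ) : Finite (CoxeterMatrix.B n).Group := by
  induction n with
  | zero =>
    set cs := (CoxeterMatrix.B 0).toCoxeterSystem
    have : Subsingleton (CoxeterMatrix.B 0).Group := by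
      refine ⟨fun a b ↦ ?_⟩
      have h : ∀ w : (CoxeterMatrix.B 0).Group, w = 1 := fun w ↦
        cs.simple_induction_left (p := fun w ↦ w = 1) w rfl (fun w i ↦ i.elim0)
      rw [h a, h b]
    infer_instance
  | succ n ih =>
    set cs := (CoxeterMatrix.B (n + 1)).toCoxeterSystem
    obtain ⟨ψ, hψ'⟩ := (CoxeterMatrix.B n).toCoxeterSystem.exists_hom
      (fun i : Fin n ↦ cs.simple i.succ) (fun i j ↦ by
        rw [← CoxeterMatrix.B_succ_succ, cs.simple_mul_simple_pow])
    have hψ : ∀ i : Fin n, cs.simple i.succ ∈ ψ.range := fun i ↦ ⟨_, hψ' i⟩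
    let s : ℕ → (CoxeterMatrix.B (n + 1)).Group :=
      fun i ↦ if h : i < n + 1 then cs.simple ⟨i, h⟩ else 1
    have hs : ∀ i (h : i < n + 1), s i = cs.simple ⟨i, h⟩ := fun i h ↦ dif_pos h
    -- The base point is the coset of the subgroup generated by all simple reflections but the
    -- first, an image of the group of rank `n`, finite by induction.
    obtain ⟨F, hF, h1, hinv⟩ := exists_finite_invariant_of_typeB_relations s n
      ((1 : (CoxeterMatrix.B (n + 1)).Group) : (CoxeterMatrix.B (n + 1)).Group ⧸ ψ.range)
      (by
        intro i
        by_cases h : i < n + 1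
        · rw [hs i h, cs.simple_mul_simple_self]
        · rw [show s i = 1 from dif_neg h, one_mul])
      (by
        intro i j hij hj
        rw [hs i (by omega), hs j (by omega)]
        apply cs.mul_comm_of_eq_two
        simp only [CoxeterMatrix.B, Matrix.of_apply, Fin.ext_iff]
        grind)
      (by
        intro i hi
        rw [hs i (by omega), hs (i + 1) (by omega)]
        apply cs.braid_of_eq_three
        simp only [CoxeterMatrix.B, Matrix.of_apply, Fin.ext_iff]
        grind)
      (by
        rintro i rfl
        rw [hs i (by omega), hs (i + 1) (by omega)]
        apply cs.braid_of_eq_four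
        simp only [CoxeterMatrix.B, Matrix.of_apply, Fin.ext_iff]
        grind)
      (by
        intro i h1 hi
        obtain ⟨i, rfl⟩ : ∃ k, i = k + 1 := ⟨i - 1, by omega⟩
        rw [hs (i + 1) (by omega), MulAction.Quotient.smul_coe, QuotientGroup.eq]
        rw [smul_eq_mul, mul_one, mul_one]
        exact inv_mem (hψ ⟨i, by omega⟩))
    have : Finite ψ.range := Finite.of_surjective ψ.rangeRestrict ψ.rangeRestrict_surjective
    refine finite_of_finite_invariant_cosets ψ.range _ cs.submonoid_closure_range_simple F hF h1 ?_
    rintro _ ⟨i, rfl⟩ z hz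
    have := hinv i (by omega) z hz
    rwa [hs i i.isLt] at this

/-- Killing the last generator of `B_{n+1}` leaves the relations of `A_n`: every relation joining it
to another generator has even exponent, so it becomes a power of `s_i ^ 2 = 1`. -/
instance CoxeterMatrix.finite_group_A (n : ℕ) : Finite (CoxeterMatrix.A n).Group := by
  set cs := (CoxeterMatrix.A n).toCoxeterSystem
  let f : Fin (n + 1) → (CoxeterMatrix.A n).Group :=
    fun i ↦ if h : (i : ℕ) < n then cs.simple ⟨i, h⟩ else 1
  have hf : ∀ (i : Fin (n + 1)) (h : (i : ℕ) < n), f i = cs.simple ⟨i, h⟩ := fun i h ↦ dif_pos h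
  have hf' : ∀ i : Fin (n + 1), ¬ (i : ℕ) < n → f i = 1 := fun i h ↦ dif_neg h
  have heven : ∀ i j : Fin (n + 1), ((i : ℕ) < n ∧ ¬ (j : ℕ) < n ∨ ¬ (i : ℕ) < n ∧ (j : ℕ) < n) →
      Even (CoxeterMatrix.B (n + 1) i j) := by
    intro i j h
    simp only [CoxeterMatrix.B, Matrix.of_apply, Fin.ext_iff]
    grind
  obtain ⟨ψ, hψ⟩ := (CoxeterMatrix.B (n + 1)).toCoxeterSystem.exists_hom f (fun i j ↦ by
    by_cases hi : (i : ℕ) < n <;> by_cases hj : (j : ℕ) < n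
    · have : CoxeterMatrix.B (n + 1) i j = CoxeterMatrix.A n ⟨i, hi⟩ ⟨j, hj⟩ := by
        simp only [CoxeterMatrix.A, CoxeterMatrix.B, Matrix.of_apply, Fin.ext_iff]
        grind
      rw [hf i hi, hf j hj, this, cs.simple_mul_simple_pow]
    · obtain ⟨m, hm⟩ := heven i j (Or.inl ⟨hi, hj⟩)
      rw [hf i hi, hf' j hj, mul_one, hm, ← two_mul, pow_mul, cs.simple_sq, one_pow]
    · obtain ⟨m, hm⟩ := heven i j (Or.inr ⟨hi, hj⟩)
      rw [hf' i hi, hf j hj, one_mul, hm, ← two_mul, pow_mul, cs.simple_sq, one_pow]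
    · rw [hf' i hi, hf' j hj, one_mul, one_pow])
  refine Finite.of_surjective ψ ?_
  rw [← MonoidHom.range_eq_top, ← top_le_iff, ← cs.subgroup_closure_range_simple,
    Subgroup.closure_le]
  rintro _ ⟨i, rfl⟩
  exact ⟨_, (hψ i.castSucc).trans (hf i.castSucc i.isLt)⟩

lemma mul_pow_eq_one_comm {G : Type*} [Group G] {a b : G} {m : ℕ} (h : (a * b) ^ m = 1) :
    (b * a) ^ m = 1 := by
  have : b * a = b * (a * b) * b⁻¹ := by group
  rw [this, conj_pow, h, mul_one, mul_inv_cancel]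

/-- To lift a map to a Coxeter group whose generators are linearly ordered, it is enough to check
half of the relations. -/
lemma CoxeterSystem.exists_hom_of_le {B W G : Type*} [LinearOrder B] [Group W] [Group G]
    {M : CoxeterMatrix B} (cs : CoxeterSystem M W) (f : B → G)
    (hf : ∀ i j, i ≤ j → (f i * f j) ^ M i j = 1) :
    ∃ φ : W →* G, ∀ i, φ (cs.simple i) = f i :=
  cs.exists_hom f fun i j ↦ by
    rcases le_total i j with h | h
    · exact hf i j h
    · rw [M.symmetric]
      exact mul_pow_eq_one_comm (hf j i h)

/-- The diagram automorphism exchanging the two vertices of the fork; it induces the involution that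
embeds `D` in an image of `B`. -/
lemma CoxeterMatrix.typeD_swap_swap (m : ℕ) (i j : Fin (m + 2)) :
    CoxeterMatrix.typeD (m + 2) (Equiv.swap (Fin.last m).castSucc (Fin.last (m + 1)) i)
      (Equiv.swap (Fin.last m).castSucc (Fin.last (m + 1)) j) =
    CoxeterMatrix.typeD (m + 2) i j := by
  rw [Equiv.swap_apply_def, Equiv.swap_apply_def]
  simp only [CoxeterMatrix.typeD, Matrix.of_apply, Fin.ext_iff]
  grind

lemma CoxeterMatrix.typeD_penultimate_last (m : ℕ) :
    CoxeterMatrix.typeD (m + 2) (Fin.last m).castSucc (Fin.last (m + 1)) = 2 := by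
  simp only [CoxeterMatrix.typeD, Matrix.of_apply, Fin.ext_iff, Fin.val_castSucc, Fin.val_last]
  grind

lemma CoxeterMatrix.B_eq_typeD (m : ℕ) (i j : Fin (m + 2)) (hi : (i : ℕ) < m + 1)
    (hj : (j : ℕ) < m + 1) :
    CoxeterMatrix.B (m + 2) i j = CoxeterMatrix.typeD (m + 2) i j := by
  simp only [CoxeterMatrix.typeD, CoxeterMatrix.B, Matrix.of_apply, Fin.ext_iff]
  grind

lemma CoxeterMatrix.B_last (m : ℕ) (i j : Fin (m + 2)) (hi : (i : ℕ) < m + 1)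
    (hj : ¬ (j : ℕ) < m + 1) :
    CoxeterMatrix.B (m + 2) i j = if (i : ℕ) = m then 4 else 2 := by
  simp only [CoxeterMatrix.B, Matrix.of_apply, Fin.ext_iff]
  grind

instance CoxeterMatrix.finite_group_typeD (n : ℕ) : Finite (CoxeterMatrix.typeD n).Group := by
  rcases Nat.lt_or_ge n 2 with hn | hn
  · have : CoxeterMatrix.typeD n = CoxeterMatrix.A n := by
      ext i j
      obtain rfl : i = j := by ext; omega
      simp
    rw [this]
    infer_instance
  obtain ⟨m, rfl⟩ : ∃ m, n = m + 2 := ⟨n - 2, by omega⟩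
  set cs := (CoxeterMatrix.typeD (m + 2)).toCoxeterSystem
  set τ : Equiv.Perm (Fin (m + 2)) := Equiv.swap (Fin.last m).castSucc (Fin.last (m + 1)) with hτ
  obtain ⟨α, hα⟩ := cs.exists_hom (fun i ↦ cs.simple (τ i)) (fun i j ↦ by
    rw [← CoxeterMatrix.typeD_swap_swap, cs.simple_mul_simple_pow])
  have hαα : α.comp α = MonoidHom.id _ := cs.ext_simple fun i ↦ by
    rw [MonoidHom.comp_apply, hα, hα, hτ, ← Equiv.Perm.mul_apply, Equiv.swap_mul_self]
    rfl
  let a : MulAut (CoxeterMatrix.typeD (m + 2)).Group := α.toMulEquiv α hαα hαα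
  have ha : ∀ i, a (cs.simple i) = cs.simple (τ i) := hα
  have haa : a * a = 1 := by ext w; exact DFunLike.congr_fun hαα w
  -- In this semidirect product the fork involution becomes an element `t`. The remaining fork
  -- generator is the `t`-conjugate of its twin, so `t` and the first `m + 1` generators satisfy the
  -- relations of `B` and generate a subgroup containing `D`.
  let G := (CoxeterMatrix.typeD (m + 2)).Group ⋊[MonoidHom.id (MulAut _)]
    MulAut (CoxeterMatrix.typeD (m + 2)).Group
  let inl : (CoxeterMatrix.typeD (m + 2)).Group →* G := SemidirectProduct.inl
  let t : G := SemidirectProduct.inr a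
  have htt : t * t = 1 := by
    rw [← map_mul, haa, map_one]
  have hconj : ∀ w, inl (a w) = t * inl w * t := by
    intro w
    have h := SemidirectProduct.inl_aut (φ := MonoidHom.id (MulAut _)) a w
    rwa [inv_eq_of_mul_eq_one_left haa] at h
  have hsq : ∀ w, (inl w * t) ^ 2 = inl (w * a w) := by
    intro w
    rw [map_mul, hconj, pow_two]
    simp only [mul_assoc]
  let f : Fin (m + 2) → G := fun i ↦ if (i : ℕ) < m + 1 then inl (cs.simple i) else t
  have hf : ∀ i : Fin (m + 2), (i : ℕ) < m + 1 → f i = inl (cs.simple i) := fun i h ↦ if_pos h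
  have hf' : ∀ i : Fin (m + 2), ¬ (i : ℕ) < m + 1 → f i = t := fun i h ↦ if_neg h
  obtain ⟨ψ, hψ⟩ := (CoxeterMatrix.B (m + 2)).toCoxeterSystem.exists_hom_of_le f (fun i j hij ↦ by
    by_cases hj : (j : ℕ) < m + 1
    · have hi : (i : ℕ) < m + 1 := lt_of_le_of_lt hij hj
      rw [hf i hi, hf j hj, CoxeterMatrix.B_eq_typeD m i j hi hj, ← map_mul, ← map_pow,
        cs.simple_mul_simple_pow, map_one]
    · by_cases hi : (i : ℕ) < m + 1
      · rw [hf i hi, hf' j hj, CoxeterMatrix.B_last m i j hi hj]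
        by_cases him : (i : ℕ) = m
        · obtain rfl : i = (Fin.last m).castSucc := Fin.ext him
          have h2 := cs.simple_mul_simple_pow (Fin.last m).castSucc (Fin.last (m + 1))
          rw [CoxeterMatrix.typeD_penultimate_last] at h2
          -- At the fork, `(s t) ^ 2` is the product of the two commuting fork generators, whence
          -- the label 4.
          rw [if_pos him, show 4 = 2 * 2 from rfl, pow_mul, hsq, ha, hτ, Equiv.swap_apply_left,
            ← map_pow, h2, map_one]
        · have h3 : τ i = i := Equiv.swap_apply_of_ne_of_ne (fun h ↦ him (congrArg Fin.val h))
            (fun h ↦ (congrArg Fin.val h ▸ hi).ne rfl)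
          rw [if_neg him, hsq, ha, h3, cs.simple_mul_simple_self, map_one]
      · rw [hf' i hi, hf' j hj, htt, one_pow])
  have hrange : ∀ i, inl (cs.simple i) ∈ ψ.range := by
    intro i
    by_cases hi : (i : ℕ) < m + 1
    · exact ⟨_, (hψ i).trans (hf i hi)⟩
    · obtain rfl : i = Fin.last (m + 1) := by ext; simp only [Fin.val_last]; omega
      have h1 : cs.simple (Fin.last (m + 1)) = a (cs.simple (Fin.last m).castSucc) := by
        rw [ha, hτ, Equiv.swap_apply_left]
      rw [h1, hconj]
      have ht : t ∈ ψ.range := ⟨_, (hψ (Fin.last (m + 1))).trans (hf' _ hi)⟩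
      exact mul_mem (mul_mem ht ⟨_, (hψ _).trans (hf _ (by simp))⟩) ht
  have hle : inl.range ≤ ψ.range := by
    rw [MonoidHom.range_eq_map, ← cs.subgroup_closure_range_simple, MonoidHom.map_closure,
      Subgroup.closure_le]
    rintro _ ⟨_, ⟨i, rfl⟩, rfl⟩
    exact hrange i
  have : Finite ψ.range := Finite.of_surjective ψ.rangeRestrict ψ.rangeRestrict_surjective
  have hfin : (Set.range inl).Finite :=
    (Set.toFinite (ψ.range : Set G)).subset (fun x hx ↦ hle hx)
  exact (Set.finite_range_iff SemidirectProduct.inl_injective).mp hfin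

/-! ### Permutation actions and limits in types A, B and D -/

lemma swap_succ_mul_swap_succ_pow {a b m : ℕ}
    (h : a = b ∨ ((a + 2 ≤ b ∨ b + 2 ≤ a) ∧ 2 ∣ m) ∨ ((a + 1 = b ∨ b + 1 = a) ∧ 3 ∣ m)) :
    (Equiv.swap a (a + 1) * Equiv.swap b (b + 1)) ^ m = 1 := by
  have key : ∀ c, (Equiv.swap c (c + 1) * Equiv.swap (c + 1) (c + 1 + 1)) ^ 3 = 1 := by
    intro c
    have h1 := Equiv.swap_mul_swap_mul_swap (x := c) (y := c + 1) (z := c + 1 + 1)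
      (by omega) (by omega)
    have h2 := Equiv.swap_mul_swap_mul_swap (x := c + 1 + 1) (y := c + 1) (z := c)
      (by omega) (by omega)
    rw [Equiv.swap_comm (c + 1) c, Equiv.swap_comm (c + 1 + 1) (c + 1)] at h2
    have : (Equiv.swap c (c + 1) * Equiv.swap (c + 1) (c + 1 + 1)) ^ 3 =
      (Equiv.swap c (c + 1) * Equiv.swap (c + 1) (c + 1 + 1) * Equiv.swap c (c + 1)) *
      (Equiv.swap (c + 1) (c + 1 + 1) * Equiv.swap c (c + 1) *
        Equiv.swap (c + 1) (c + 1 + 1)) := by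
      simp only [pow_succ, pow_zero, one_mul, mul_assoc]
    rw [this, h1, h2, Equiv.swap_comm (c + 1 + 1) c, Equiv.swap_mul_self]
  rcases h with rfl | ⟨h, k, rfl⟩ | ⟨rfl | rfl, k, rfl⟩
  · rw [Equiv.swap_mul_self, one_pow]
  · have hd : Equiv.Perm.Disjoint (Equiv.swap a (a + 1)) (Equiv.swap b (b + 1)) := by
      intro x
      rw [Equiv.swap_apply_def, Equiv.swap_apply_def]
      split_ifs <;> omega
    rw [pow_mul, hd.commute.mul_pow, pow_two, pow_two, Equiv.swap_mul_self, Equiv.swap_mul_self,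
      one_mul, one_pow]
  · rw [pow_mul, key, one_pow]
  · rw [pow_mul, mul_pow_eq_one_comm (key b), one_pow]

lemma tendsto_probSpherical_A :
    Tendsto (fun n : ℕ ↦ (CoxeterMatrix.A n).toCoxeterSystem.probSpherical) atTop (𝓝 0) := by
  have h : ∀ n, ∃ φ : (CoxeterMatrix.A n).Group →* Equiv.Perm ℕ, ∀ i,
      φ ((CoxeterMatrix.A n).toCoxeterSystem.simple i) = Equiv.swap (i : ℕ) (i + 1) := by
    intro n
    refine CoxeterSystem.exists_hom _ (fun i : Fin n ↦ Equiv.swap (i : ℕ) (i + 1)) fun i j ↦ ?_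
    apply swap_succ_mul_swap_succ_pow
    simp only [CoxeterMatrix.A, Matrix.of_apply, Fin.ext_iff]
    grind
  choose φ hφ using h
  refine tendsto_probSpherical_zero φ (fun n i _ ↦ hφ n i) ?_ ?_
  · intro n i hi x hx
    rw [hφ]
    exact Equiv.swap_apply_of_ne_of_ne (by omega) (by omega)
  · intro n i j hij hj
    simp only [CoxeterMatrix.A, Matrix.of_apply, Fin.ext_iff]
    grind

lemma tendsto_probSpherical_B :
    Tendsto (fun n : ℕ ↦ (CoxeterMatrix.B n).toCoxeterSystem.probSpherical) atTop (𝓝 0) := by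
  have h : ∀ n, ∃ φ : (CoxeterMatrix.B n).Group →* Equiv.Perm ℕ, ∀ i,
      φ ((CoxeterMatrix.B n).toCoxeterSystem.simple i) =
        if (i : ℕ) + 1 < n then Equiv.swap (i : ℕ) (i + 1) else 1 := by
    intro n
    -- Forgetting signs in the signed permutation group makes the last generator act trivially.
    refine CoxeterSystem.exists_hom_of_le _
      (fun i : Fin n ↦ if (i : ℕ) + 1 < n then Equiv.swap (i : ℕ) (i + 1) else 1)
      fun i j hij ↦ ?_
    by_cases hj : (j : ℕ) + 1 < n
    · rw [if_pos (lt_of_le_of_lt (Nat.succ_le_succ hij) hj), if_pos hj]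
      apply swap_succ_mul_swap_succ_pow
      simp only [CoxeterMatrix.B, Matrix.of_apply, Fin.ext_iff]
      grind
    · rw [if_neg hj, mul_one]
      by_cases hi : (i : ℕ) + 1 < n
      · have : Even (CoxeterMatrix.B n i j) := by
          simp only [CoxeterMatrix.B, Matrix.of_apply, Fin.ext_iff]
          grind
        obtain ⟨m, hm⟩ := this
        rw [if_pos hi, hm, ← two_mul, pow_mul, pow_two, Equiv.swap_mul_self, one_pow]
      · rw [if_neg hi, one_pow]
  choose φ hφ using h
  refine tendsto_probSpherical_zero φ (fun n i hi ↦ (hφ n i).trans (if_pos hi)) ?_ ?_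
  · intro n i hi x hx
    rw [hφ, if_neg (by omega), Equiv.Perm.one_apply]
  · intro n i j hij hj
    simp only [CoxeterMatrix.B, Matrix.of_apply, Fin.ext_iff]
    grind

lemma tendsto_probSpherical_typeD :
    Tendsto (fun n : ℕ ↦ (CoxeterMatrix.typeD n).toCoxeterSystem.probSpherical) atTop (𝓝 0) := by
  -- Forgetting signs makes the last generator act as its twin at the fork, by the transposition of
  -- `n - 2` and `n - 1`.
  let c : ℕ → ℕ → ℕ := fun n i ↦ if i + 1 < n then i else n - 2
  have hc : ∀ n i, i + 1 < n → c n i = i := fun n i h ↦ if_pos h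
  have hc' : ∀ n i, ¬ i + 1 < n → c n i = n - 2 := fun n i h ↦ if_neg h
  have h : ∀ n, ∃ φ : (CoxeterMatrix.typeD n).Group →* Equiv.Perm ℕ, ∀ i,
      φ ((CoxeterMatrix.typeD n).toCoxeterSystem.simple i) =
        Equiv.swap (c n i) (c n i + 1) := by
    intro n
    refine CoxeterSystem.exists_hom_of_le _
      (fun i : Fin n ↦ Equiv.swap (c n i) (c n i + 1)) fun i j hij ↦ ?_
    apply swap_succ_mul_swap_succ_pow
    simp only [CoxeterMatrix.typeD, Matrix.of_apply, Fin.ext_iff]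
    have hij' : (i : ℕ) ≤ j := hij
    by_cases hj : (j : ℕ) + 1 < n
    · rw [hc n i (by omega), hc n j hj]
      grind
    · by_cases hi : (i : ℕ) + 1 < n
      · rw [hc n i hi, hc' n j hj]
        grind
      · rw [hc' n i hi, hc' n j hj]
        exact Or.inl rfl
  choose φ hφ using h
  refine tendsto_probSpherical_zero φ (fun n i hi ↦ ?_) ?_ ?_
  · rw [hφ, hc n i hi]
  · intro n i hi x hx
    rw [hφ, hc' n i (by omega)]
    exact Equiv.swap_apply_of_ne_of_ne (by omega) (by omega)
  · intro n i j hij hj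
    simp only [CoxeterMatrix.typeD, Matrix.of_apply, Fin.ext_iff]
    grind

/-! ### Dihedral groups -/

instance CoxeterMatrix.finite_group_I (m : ℕ) : Finite (CoxeterMatrix.I m).Group := by
  set cs := (CoxeterMatrix.I m).toCoxeterSystem
  set p := cs.simple 0 * cs.simple 1 with hp
  have hpow : p ^ (m + 2) = 1 := cs.simple_mul_simple_pow 0 1
  have : Finite (Subgroup.zpowers p) := by
    exact Set.finite_coe_iff.mpr
      (finite_zpowers.mpr (isOfFinOrder_iff_pow_eq_one.mpr ⟨m + 2, by omega, hpow⟩))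
  have hpm : p ∈ Subgroup.zpowers p := Subgroup.mem_zpowers p
  -- Modulo the rotations both reflections give the same coset, and each exchanges it with the
  -- trivial one.
  refine finite_of_finite_invariant_cosets (Subgroup.zpowers p) _ cs.submonoid_closure_range_simple
    {((1 : (CoxeterMatrix.I m).Group) : (CoxeterMatrix.I m).Group ⧸ Subgroup.zpowers p),
      ((cs.simple 0 : (CoxeterMatrix.I m).Group) : (CoxeterMatrix.I m).Group ⧸ Subgroup.zpowers p)}
    (Set.toFinite _) (Set.mem_insert _ _) ?_
  have key : ∀ i : Fin 2, (cs.simple i : (CoxeterMatrix.I m).Group ⧸ Subgroup.zpowers p) =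
      cs.simple 0 := by
    intro i
    fin_cases i
    · rfl
    · rw [eq_comm, QuotientGroup.eq, cs.inv_simple]
      exact hpm
  have key' : ∀ i : Fin 2, ((cs.simple i * cs.simple 0 : (CoxeterMatrix.I m).Group) :
      (CoxeterMatrix.I m).Group ⧸ Subgroup.zpowers p) = (1 : (CoxeterMatrix.I m).Group) := by
    intro i
    fin_cases i
    · exact congrArg _ (cs.simple_mul_simple_self 0)
    · rw [QuotientGroup.eq, mul_one, mul_inv_rev, cs.inv_simple, cs.inv_simple]
      exact hpm
  rintro _ ⟨i, rfl⟩ _ (rfl | rfl)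
  · right
    rw [MulAction.Quotient.smul_coe, smul_eq_mul, mul_one, key i]
    rfl
  · left
    rw [MulAction.Quotient.smul_coe, smul_eq_mul, key' i]

/-- The concrete dihedral group shows that the rotation `s_0 s_1` does not collapse: its image has
order `m + 2`. -/
lemma CoxeterMatrix.le_card_group_I (m : ℕ) : m + 2 ≤ Nat.card (CoxeterMatrix.I m).Group := by
  set cs := (CoxeterMatrix.I m).toCoxeterSystem
  obtain ⟨φ, hφ⟩ := cs.exists_hom_of_le
    (fun i : Fin 2 ↦ (DihedralGroup.sr ((i : ℕ) : ZMod (m + 2)) : DihedralGroup (m + 2)))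
    (fun i j hij ↦ by
      rw [DihedralGroup.sr_mul_sr]
      rcases eq_or_lt_of_le hij with rfl | h
      · rw [sub_self, DihedralGroup.r_zero, one_pow]
      · obtain rfl : i = 0 := by omega
        obtain rfl : j = 1 := by omega
        simp [CoxeterMatrix.I])
  have h : φ (cs.simple 0 * cs.simple 1) = DihedralGroup.r 1 := by
    rw [map_mul, hφ, hφ, DihedralGroup.sr_mul_sr]
    simp
  have hdvd := orderOf_map_dvd φ (cs.simple 0 * cs.simple 1)
  rw [h, DihedralGroup.orderOf_r_one] at hdvd
  exact (Nat.le_of_dvd (orderOf_pos _) hdvd).trans orderOf_le_card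

lemma CoxeterSystem.IsReduced.isChain_ne {B W : Type*} [Group W] {M : CoxeterMatrix B}
    {cs : CoxeterSystem M W} {ω : List B} (hω : cs.IsReduced ω) : ω.IsChain (· ≠ ·) := by
  rw [List.isChain_iff_forall_rel_of_append_cons_cons]
  rintro a b l₁ l₂ rfl rfl
  have h := cs.length_wordProd_le (l₁ ++ l₂)
  have h2 : cs.wordProd (l₁ ++ a :: a :: l₂) = cs.wordProd (l₁ ++ l₂) := by
    simp [CoxeterSystem.wordProd_append, CoxeterSystem.wordProd_cons]
  rw [← h2, hω] at h
  simp at h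

lemma List.IsChain.eq_of_fin_two : ∀ {a : Fin 2} {l l' : List (Fin 2)},
    (a :: l).IsChain (· ≠ ·) → (a :: l').IsChain (· ≠ ·) → l.length = l'.length → l = l'
  | _, [], [], _, _, _ => rfl
  | a, b :: l, c :: l', h, h', hl => by
    rw [List.isChain_cons_cons] at h h'
    obtain rfl : b = c := by omega
    rw [List.IsChain.eq_of_fin_two h.2 h'.2 (by simpa using hl)]

namespace CoxeterSystem

variable {W : Type*} [Group W] {M : CoxeterMatrix (Fin 2)} (cs : CoxeterSystem M W)

/-- In rank two, an element with both left descents is determined by its length. -/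
lemma wordProd_eq_of_leftDescents {v : W} (hv : ∀ i, cs.IsLeftDescent v i) {ω : List (Fin 2)}
    (hω : ω.IsChain (· ≠ ·)) (hl : ω.length = cs.length v) : cs.wordProd ω = v := by
  rcases ω with _ | ⟨a, ω⟩
  · rw [wordProd_nil, eq_comm, ← cs.length_eq_zero_iff, ← hl, List.length_nil]
  -- Since `a` is a descent, `v` has a reduced word starting with `a`; an alternating word is
  -- determined by its first letter and its length.
  obtain ⟨ω', hω', h⟩ := cs.exists_isReduced (cs.simple a * v)
  have h1 := cs.isLeftDescent_iff.mp (hv a)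
  have h2 : cs.wordProd (a :: ω') = v := by
    rw [wordProd_cons, ← h, simple_mul_simple_cancel_left]
  have h3 : ω'.length + 1 = cs.length v := by rw [← h1, h, hω'.eq]
  have h4 : cs.IsReduced (a :: ω') := by rw [IsReduced, h2, List.length_cons, h3]
  rw [List.IsChain.eq_of_fin_two hω h4.isChain_ne (by simp at hl; omega), h2]

lemma length_le_of_leftDescents {v : W} (hv : ∀ i, cs.IsLeftDescent v i) (w : W) :
    cs.length w ≤ cs.length v := by
  by_contra! hlt
  obtain ⟨ω, hω, rfl⟩ := cs.exists_isReduced w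
  rw [hω.eq] at hlt
  -- A suffix `a :: l` of length `ℓ(v) + 1` is reduced and `l` represents `v`, so `s_a` would
  -- lengthen `v`.
  have h1 := hω.drop (ω.length - (cs.length v + 1))
  have hlen : (ω.drop (ω.length - (cs.length v + 1))).length = cs.length v + 1 := by
    rw [List.length_drop]; omega
  obtain ⟨a, l, hal⟩ := List.exists_cons_of_length_eq_add_one hlen
  rw [hal] at h1 hlen
  have hl : l.length = cs.length v := by simpa using hlen
  have h2 : cs.wordProd l = v :=
    cs.wordProd_eq_of_leftDescents hv (by simpa using (h1.drop 1).isChain_ne) hl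
  have h3 := hv a
  rw [IsLeftDescent, ← h2, ← wordProd_cons, h1.eq, h2, hlen] at h3
  omega

lemma eq_of_leftDescents {v w : W} (hv : ∀ i, cs.IsLeftDescent v i)
    (hw : ∀ i, cs.IsLeftDescent w i) : v = w := by
  obtain ⟨ω, hω, rfl⟩ := cs.exists_isReduced v
  exact cs.wordProd_eq_of_leftDescents hw hω.isChain_ne
    (hω.eq.symm.trans (le_antisymm (cs.length_le_of_leftDescents hw _)
      (cs.length_le_of_leftDescents hv _)))

/-- Among any four consecutive letters of an alternating word in two letters, each occurs twice. -/
lemma length_le_three_of_count_le_one {ω : List (Fin 2)} (hω : ω.IsChain (· ≠ ·)) {j : Fin 2}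
    (hj : ω.count j ≤ 1) : ω.length ≤ 3 := by
  rcases ω with _ | ⟨a, _ | ⟨b, _ | ⟨c, _ | ⟨d, ω⟩⟩⟩⟩
  · simp
  · simp
  · simp
  · simp
  simp only [List.isChain_cons_cons, List.count_cons, beq_iff_eq] at hω hj
  obtain ⟨h1, h2, h3, -⟩ := hω
  split_ifs at hj <;> omega

lemma card_spherical_le [Finite W] :
    Nat.card {w : W // cs.IsSpherical (cs.leftDescents w) w} ≤
      {ω : List (Fin 2) | ω.length ≤ 3}.ncard + 1 := by
  have hsub : {w : W | cs.IsSpherical (cs.leftDescents w) w} ⊆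
      cs.wordProd '' {ω | ω.length ≤ 3} ∪ {w | ∀ i, cs.IsLeftDescent w i} := by
    rintro _ ⟨-, ω, hω, rfl, hcount, -⟩
    by_cases h : ∀ i, cs.IsLeftDescent (cs.wordProd ω) i
    · exact Or.inr h
    · push Not at h
      obtain ⟨i, hi⟩ := h
      exact Or.inl ⟨ω, length_le_three_of_count_le_one hω.isChain_ne (by convert hcount i hi), rfl⟩
  refine (Set.ncard_le_ncard hsub (Set.toFinite _)).trans ((Set.ncard_union_le _ _).trans ?_)
  refine Nat.add_le_add (Set.ncard_image_le (List.finite_length_le _ 3)) ?_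
  exact (Set.ncard_le_one (Set.toFinite _)).mpr fun v hv w hw ↦ cs.eq_of_leftDescents hv hw

end CoxeterSystem

lemma tendsto_probSpherical_I :
    Tendsto (fun n : ℕ ↦ (CoxeterMatrix.I (n - 2)).toCoxeterSystem.probSpherical)
      atTop (𝓝 0) := by
  set C : ℕ := {ω : List (Fin 2) | ω.length ≤ 3}.ncard + 1
  refine squeeze_zero' (Eventually.of_forall fun n ↦
    div_nonneg (Nat.cast_nonneg _) (Nat.cast_nonneg _)) ?_
    (tendsto_const_nhds.div_atTop tendsto_natCast_atTop_atTop : Tendsto (fun n : ℕ ↦ (C : ℝ) / n)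
      atTop (𝓝 0))
  filter_upwards [eventually_ge_atTop 2] with n hn
  have h1 := (CoxeterMatrix.I (n - 2)).toCoxeterSystem.card_spherical_le
  have h2 := CoxeterMatrix.le_card_group_I (n - 2)
  rw [Nat.sub_add_cancel hn] at h2
  rw [CoxeterSystem.probSpherical]
  have hn' : (0 : ℝ) < n := by exact_mod_cast (by omega : 0 < n)
  exact div_le_div₀ (Nat.cast_nonneg _) (by exact_mod_cast h1) hn' (by exact_mod_cast h2)

/-- The matrix `CoxeterMatrix.I m` has the off-diagonal entry `m + 2`, so `CoxeterMatrix.I (n - 2)`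
is the Coxeter matrix of type `I_2(n)` for `n ≥ 2`. -/
theorem theorem1p3 :
    ((∀ n : ℕ, Finite (CoxeterMatrix.A n).Group) ∧
      Tendsto (fun n : ℕ ↦ (CoxeterMatrix.A n).toCoxeterSystem.probSpherical) atTop (𝓝 0)) ∧
    ((∀ n : ℕ, Finite (CoxeterMatrix.B n).Group) ∧
      Tendsto (fun n : ℕ ↦ (CoxeterMatrix.B n).toCoxeterSystem.probSpherical) atTop (𝓝 0)) ∧
    ((∀ n : ℕ, Finite (CoxeterMatrix.typeD n).Group) ∧
      Tendsto (fun n : ℕ ↦ (CoxeterMatrix.typeD n).toCoxeterSystem.probSpherical) atTop (𝓝 0)) ∧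
    ((∀ n : ℕ, Finite (CoxeterMatrix.I (n - 2)).Group) ∧
      Tendsto (fun n : ℕ ↦ (CoxeterMatrix.I (n - 2)).toCoxeterSystem.probSpherical)
        atTop (𝓝 0)) :=
  ⟨⟨fun _ ↦ inferInstance, tendsto_probSpherical_A⟩,
    ⟨fun _ ↦ inferInstance, tendsto_probSpherical_B⟩,
    ⟨fun _ ↦ inferInstance, tendsto_probSpherical_typeD⟩,
    ⟨fun _ ↦ inferInstance, tendsto_probSpherical_I⟩⟩
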